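/- For integers $r,s,t\ge 1$ let $\theta(r,s,t)$ be the theta graph formed by connecting two base vertices by three internally disjoint paths (the $R$-, $S$- and $T$-path) of lengths $r$, $s$ and $t$, so that it has $m=r+s+t$ edges (if two or three of $r,s,t$ equal $1$, it has parallel edges). Let $\mathrm{Sh}(3)\subset\mathbb{R}^3$ be the set of all vectors obtained by permuting the coordinates of some $(v_1,v_2,v_3)\in\mathbb{R}^3$ with $v_1+v_2+v_3=3$ and $v_i\le v_{i+1}\le v_i+1$ for $i=1,2$. Let $\mathrm{Sh}(r,s,t)\subset\mathbb{R}^m$ be the set of vectors indexed by the edges of $\theta(r,s,t)$ that take a constant value $\alpha$ on the $R$-path, a constant value $\beta$ on the $S$-path and a constant value $\gamma$ on the $T$-path, for some $(\alpha,\beta,\gamma)\in \mathrm{Sh}(3)$. For $\mathbf{s}\in\mathbb{R}^m$ let $M_{\mathbf{s}}$ be the distribution of the minimum-weight spanning tree of $\theta(r,s,t)$ when the weights of the edges $e$ are drawn independently, each uniformly from the interval $[s_e,s_e+1]$. **Theorem.** For all integers $r,s,t\ge 1$ there exists $\mathbf{s}\in\mathrm{Sh}(r,s,t)$ such that $M_{\mathbf{s}}$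 is the uniform distribution on the set of all spanning trees of $\theta(r,s,t)$. -/

import Mathlib

open MeasureTheory

namespace RandomTrees

/-! ### Spanning trees of a finite (multi)graph -/

section Trees

variable {α β : Type*}

/-- `IsWalk G x es y`: the list of edges `es` is a walk in `G` from the vertex `x` to the
vertex `y`. -/
inductive IsWalk (G : Graph α β) : α → List β → α → Prop
  | nil {x : α} (hx : x ∈ G.vertexSet) : IsWalk G x [] x
  | cons {e : β} {x y z : α} {es : List β} (h : G.IsLink e x y) (hw : IsWalk G y es z) :
      IsWalk G x (e :: es) z

/-- A graph is connected if it has a vertex and any two vertices are joined by a walk. -/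
def IsConnected (G : Graph α β) : Prop :=
  G.vertexSet.Nonempty ∧
    ∀ x ∈ G.vertexSet, ∀ y ∈ G.vertexSet, ∃ es : List β, IsWalk G x es y

/-- A graph is acyclic if it has no closed walk of positive length with pairwise distinct edges.
(A loop is such a walk of length one, a pair of parallel edges gives one of length two.) -/
def IsAcyclic (G : Graph α β) : Prop :=
  ∀ (x : α) (es : List β), IsWalk G x es x → es.Nodup → es = []

/-- `T` is the edge set of a spanning tree of `G`: the subgraph of `G` with all the vertices of `G`
and with edge set `T` is a tree. -/
def IsSpanningTree (G : Graph α β) (T : Finset β) : Prop :=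
  (T : Set β) ⊆ G.edgeSet ∧ IsConnected (G.restrict (T : Set β)) ∧
    IsAcyclic (G.restrict (T : Set β))

/-- The set of all spanning trees of `G`, each given by its set of edges. -/
abbrev SpanningTree (G : Graph α β) : Type _ := {T : Finset β // IsSpanningTree G T}

/-- `T` is the minimum spanning tree of `G` for the edge weights `w`: its total weight is smaller
than that of any other spanning tree. -/
def IsMST (G : Graph α β) (w : β → ℝ) (T : SpanningTree G) : Prop :=
  ∀ T' : SpanningTree G, T' ≠ T → ∑ e ∈ T.1, w e < ∑ e ∈ T'.1, w e

/-- The law of independent edge weights, where the weight of the edge `e` is uniform on the unit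
interval `[S e, S e + 1]`. -/
noncomputable def shiftedWeights [Fintype β] (S : β → ℝ) : Measure (β → ℝ) :=
  Measure.pi fun e => volume.restrict (Set.Icc (S e) (S e + 1))

/-- Shifted-interval MST `M_S`, as a function on the set of spanning trees: the probability that
`T` is the minimum spanning tree for random weights with law `shiftedWeights S`. -/
noncomputable def shiftedMST [Fintype β] (G : Graph α β) (S : β → ℝ) : SpanningTree G → ℝ :=
  fun T => (shiftedWeights S).real {w : β → ℝ | IsMST G w T}

/-- The uniform distribution UST on the set of spanning trees. -/
noncomputable def ust (G : Graph α β) : SpanningTree G → ℝ :=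
  fun _ => 1 / (Nat.card (SpanningTree G) : ℝ)

end Trees

/-! ### Shifts -/

/-- The non-decreasing vectors in `ℝ^m` with coordinate sum `m.choose 2` and with gaps at most `1`
between successive coordinates. -/
def sortedShifts (m : ℕ) : Set (Fin m → ℝ) :=
  {v | ∑ i, v i = (m.choose 2 : ℝ) ∧
    ∀ i j : Fin m, (j : ℕ) = (i : ℕ) + 1 → v i ≤ v j ∧ v j ≤ v i + 1}

/-- The shiftahedron `Sh(m)`: all reorderings of the vectors in `sortedShifts m`. -/
def shiftahedron (m : ℕ) : Set (Fin m → ℝ) :=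
  {u | ∃ v ∈ sortedShifts m, ∃ σ : Equiv.Perm (Fin m), u = fun i => v (σ i)}

/-! ### Theta graphs -/

/-- The lengths of the three paths of `θ(r,s,t)`. -/
def pathLength (r s t : ℕ) : Fin 3 → ℕ := ![r, s, t]

/-- The edges of `θ(r,s,t)`: the pair `⟨i, k⟩` is the `k`-th edge of the `i`-th path, where
`i = 0, 1, 2` stands for the `R`-, `S`- and `T`-path. -/
abbrev ThetaEdge (r s t : ℕ) : Type := Σ i : Fin 3, Fin (pathLength r s t i)

/-- The vertices of `θ(r,s,t)`: the two base vertices, and the interior vertices of the paths. -/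
inductive ThetaVertex (r s t : ℕ) : Type
  | left : ThetaVertex r s t
  | right : ThetaVertex r s t
  | inner (i : Fin 3) (k : Fin (pathLength r s t i - 1)) : ThetaVertex r s t

/-- The vertex at distance `k` from the left base vertex along the `i`-th path. -/
def pathVertex (r s t : ℕ) (i : Fin 3) (k : ℕ) : ThetaVertex r s t :=
  if _h0 : k = 0 then ThetaVertex.left
  else if h : k < pathLength r s t i then ThetaVertex.inner i ⟨k - 1, by omega⟩
  else ThetaVertex.right

/-- The theta graph `θ(r,s,t)`: two base vertices connected by disjoint paths of lengths
`r`, `s` and `t`. -/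
def theta (r s t : ℕ) : Graph (ThetaVertex r s t) (ThetaEdge r s t) where
  vertexSet := Set.univ
  edgeSet := Set.univ
  IsLink e x y :=
    s(x, y) = s(pathVertex r s t e.1 (e.2 : ℕ), pathVertex r s t e.1 ((e.2 : ℕ) + 1))
  isLink_symm := by
    intro e _
    constructor
    intro x y h
    rw [Sym2.eq_swap]
    exact h
  eq_or_eq_of_isLink_of_isLink := by
    intro e x y v w h h'
    have hh := h.trans h'.symm
    rw [Sym2.eq_iff] at hh
    tauto
  edge_mem_iff_exists_isLink := by
    intro e
    simp only [Set.mem_univ, true_iff]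
    exact ⟨_, _, rfl⟩
  left_mem_of_isLink := by
    intro e x y _
    exact Set.mem_univ x

/-- `Sh(r,s,t)`: the shift vectors on the edges of `θ(r,s,t)` that are equal to `α` on the
`R`-path, to `β` on the `S`-path and to `γ` on the `T`-path, with `(α, β, γ) ∈ Sh(3)`. -/
def thetaShifts (r s t : ℕ) : Set (ThetaEdge r s t → ℝ) :=
  {S | ∃ a ∈ shiftahedron 3, S = fun e => a e.1}

end RandomTrees

namespace RandomTrees

/-! ### A zero of a pair of functions on the square -/

/-! A spanning tree keeps one path whole and omits one edge from each of the other two. The minimum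
one omits the heaviest edge of each path, except on the path whose maximum is the smallest of the
three, which stays whole. Shifts are constant on paths, so every edge of a path is equally likely to
be its heaviest, independently of the value of the maximum. Trees keeping the same path thus have
equal probability, and only three numbers remain to be equated: with `n i` the path lengths, these
are `n i ^ 2 * smallestIntegral n a i` up to a common factor (`shiftedMST_spanningTreeOf_eq`).

Order the lengths as p ≥ q ≥ r and give the longest path the lowest shift, with gaps x and y in [0,
1] to the next shifts. Two equations in (x, y) are left, solved on the unit square by a
Poincaré–Miranda argument (`exists_gaps`). At gap 1 the upper of two neighbouring paths almost
surely cannot have the smaller maximum, so its term vanishes. At gap 0 the opposite inequality is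
needed: of two paths with the same shift, the longer has the smaller term (`sq_mul_minIntegral_le`).
Without the third path the two terms agree; the third path contributes a decreasing weight, and the
difference of densities changes sign once, from negative to positive, so the weighted integral is
nonpositive. -/

/-- A planar Poincaré–Miranda theorem for pairs whose first component is monotone in the first
variable. -/
theorem exists_common_zero_of_monotone {f g : ℝ × ℝ → ℝ} (hf : Continuous f) (hg : Continuous g)
    (hmono : ∀ y ∈ Set.Icc (0 : ℝ) 1, Monotone fun x => f (x, y))
    (hf0 : ∀ y ∈ Set.Icc (0 : ℝ) 1, f (0, y) ≤ 0) (hf1 : ∀ y ∈ Set.Icc (0 : ℝ) 1, 0 ≤ f (1, y))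
    (hg0 : ∀ x ∈ Set.Icc (0 : ℝ) 1, g (x, 0) ≤ 0) (hg1 : ∀ x ∈ Set.Icc (0 : ℝ) 1, 0 ≤ g (x, 1)) :
    ∃ x ∈ Set.Icc (0 : ℝ) 1, ∃ y ∈ Set.Icc (0 : ℝ) 1, f (x, y) = 0 ∧ g (x, y) = 0 := by
  have hzero : ∀ y ∈ Set.Icc (0 : ℝ) 1, ∃ x ∈ Set.Icc (0 : ℝ) 1, f (x, y) = 0 := fun y hy =>
    intermediate_value_Icc (f := fun x => f (x, y)) zero_le_one
      (by fun_prop) ⟨hf0 y hy, hf1 y hy⟩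
  let Q : Set (ℝ × ℝ) := Set.Icc 0 1 ×ˢ Set.Icc 0 1
  have hQ : IsCompact Q := isCompact_Icc.prod isCompact_Icc
  let Zp : Set (ℝ × ℝ) := Q ∩ {p | f p = 0 ∧ 0 ≤ g p}
  let Zm : Set (ℝ × ℝ) := Q ∩ {p | f p = 0 ∧ g p ≤ 0}
  have hZp : IsCompact Zp := hQ.inter_right
    ((isClosed_eq hf continuous_const).inter (isClosed_le continuous_const hg))
  have hZm : IsCompact Zm := hQ.inter_right
    ((isClosed_eq hf continuous_const).inter (isClosed_le hg continuous_const))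
  -- Every level y carries a zero of `f`, where `g` has one sign or the other. Connectedness of [0,
  -- 1] yields a level carrying zeros of `f` with both signs of `g`.
  have hcov : Set.Icc (0 : ℝ) 1 ⊆ Prod.snd '' Zp ∪ Prod.snd '' Zm := by
    intro y hy
    obtain ⟨x, hx, h0⟩ := hzero y hy
    rcases le_total 0 (g (x, y)) with h | h
    · exact Or.inl ⟨(x, y), ⟨⟨hx, hy⟩, h0, h⟩, rfl⟩
    · exact Or.inr ⟨(x, y), ⟨⟨hx, hy⟩, h0, h⟩, rfl⟩
  have h0 : (0 : ℝ) ∈ Set.Icc (0 : ℝ) 1 := ⟨le_rfl, zero_le_one⟩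
  have h1 : (1 : ℝ) ∈ Set.Icc (0 : ℝ) 1 := ⟨zero_le_one, le_rfl⟩
  obtain ⟨y, hy, ⟨⟨x₁, y₁⟩, ⟨⟨hx₁, -⟩, hf₁, hg₁⟩, rfl⟩, ⟨⟨x₂, y₂⟩, ⟨⟨hx₂, -⟩, hf₂, hg₂⟩, hy₂⟩⟩ :=
    isPreconnected_closed_iff.1 (isPreconnected_Icc (a := (0 : ℝ)) (b := 1)) _ _
      (hZp.image continuous_snd).isClosed (hZm.image continuous_snd).isClosed hcov
      (by
        obtain ⟨x, hx, h⟩ := hzero 1 h1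
        exact ⟨1, h1, (x, 1), ⟨⟨hx, h1⟩, h, hg1 x hx⟩, rfl⟩)
      (by
        obtain ⟨x, hx, h⟩ := hzero 0 h0
        exact ⟨0, h0, (x, 0), ⟨⟨hx, h0⟩, h, hg0 x hx⟩, rfl⟩)
  dsimp only at hy hy₂
  subst hy₂
  -- `g` vanishes somewhere between the two zeros of `f` on this level, and monotonicity squeezes
  -- `f` to zero on the whole segment between them.
  obtain ⟨x, hx, hgx⟩ := intermediate_value_uIcc (f := fun x => g (x, y₂)) (a := x₂) (b := x₁)
    (by fun_prop) (Set.Icc_subset_uIcc ⟨hg₂, hg₁⟩)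
  refine ⟨x, ⟨(le_inf hx₂.1 hx₁.1).trans hx.1, hx.2.trans (sup_le hx₂.2 hx₁.2)⟩, y₂, hy,
    le_antisymm ?_ ?_, hgx⟩
  · rcases le_total x₂ x₁ with h | h
    · rw [Set.uIcc_of_le h] at hx
      exact hf₁ ▸ hmono y₂ hy hx.2
    · rw [Set.uIcc_of_ge h] at hx
      exact hf₂ ▸ hmono y₂ hy hx.2
  · rcases le_total x₂ x₁ with h | h
    · rw [Set.uIcc_of_le h] at hx
      exact hf₂ ▸ hmono y₂ hy hx.1
    · rw [Set.uIcc_of_ge h] at hx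
      exact hf₁ ▸ hmono y₂ hy hx.1

/-! ### The law of the maximum of independent uniform variables -/

/-- The distribution function of the maximum of `n` independent uniform variables on `[0, 1]`. -/
noncomputable def maxCDF (n : ℕ) (v : ℝ) : ℝ := (max 0 (min v 1)) ^ n

theorem continuous_maxCDF (n : ℕ) : Continuous (maxCDF n) := by
  unfold maxCDF; fun_prop

theorem maxCDF_mono (n : ℕ) : Monotone (maxCDF n) := fun v w h => by
  unfold maxCDF; gcongr

theorem maxCDF_le_one (n : ℕ) (v : ℝ) : maxCDF n v ≤ 1 :=
  pow_le_one₀ (le_max_left _ _) (max_le zero_le_one (min_le_right _ _))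

theorem maxCDF_of_one_le (n : ℕ) {v : ℝ} (hv : 1 ≤ v) : maxCDF n v = 1 := by
  simp [maxCDF, hv]

theorem maxCDF_of_mem {n : ℕ} {v : ℝ} (h0 : 0 ≤ v) (h1 : v ≤ 1) : maxCDF n v = v ^ n := by
  simp [maxCDF, h0, h1]

/-- Up to a factor, the probability that the maximum `A` of `p` uniform variables on `[0, 1]` is
smaller than the maxima of `q` and `r` uniform variables on `[-x, 1 - x]` and `[-y, 1 - y]`. -/
noncomputable def minIntegral (p q r : ℕ) (x y : ℝ) : ℝ :=
  ∫ u in (0 : ℝ)..1, u ^ (p - 1) * ((1 - maxCDF q (u + x)) * (1 - maxCDF r (u + y)))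

theorem continuous_minIntegrand (p q r : ℕ) : Continuous fun z : (ℝ × ℝ) × ℝ =>
    z.2 ^ (p - 1) * ((1 - maxCDF q (z.2 + z.1.1)) * (1 - maxCDF r (z.2 + z.1.2))) := by
  have := continuous_maxCDF q
  have := continuous_maxCDF r
  fun_prop

theorem continuous_minIntegral (p q r : ℕ) :
    Continuous fun z : ℝ × ℝ => minIntegral p q r z.1 z.2 :=
  intervalIntegral.continuous_parametric_intervalIntegral_of_continuous'
    (f := fun (z : ℝ × ℝ) (u : ℝ) =>
      u ^ (p - 1) * ((1 - maxCDF q (u + z.1)) * (1 - maxCDF r (u + z.2))))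
    (continuous_minIntegrand p q r) 0 1

theorem intervalIntegrable_minIntegrand (p q r : ℕ) (x y : ℝ) : IntervalIntegrable
    (fun u : ℝ => u ^ (p - 1) * ((1 - maxCDF q (u + x)) * (1 - maxCDF r (u + y)))) volume 0 1 :=
  ((continuous_minIntegrand p q r).comp (f := fun u : ℝ => ((x, y), u))
    (by fun_prop)).intervalIntegrable 0 1

theorem minIntegral_swap (p q r : ℕ) (x y : ℝ) :
    minIntegral p q r x y = minIntegral p r q y x := by
  unfold minIntegral
  congr 1
  ext u
  ring

theorem minIntegral_nonneg (p q r : ℕ) (x y : ℝ) : 0 ≤ minIntegral p q r x y := by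
  refine intervalIntegral.integral_nonneg zero_le_one fun u hu => ?_
  exact mul_nonneg (pow_nonneg hu.1 _)
    (mul_nonneg (sub_nonneg.2 (maxCDF_le_one _ _)) (sub_nonneg.2 (maxCDF_le_one _ _)))

theorem minIntegral_anti (p q r : ℕ) {x x' y y' : ℝ} (hx : x ≤ x') (hy : y ≤ y') :
    minIntegral p q r x' y' ≤ minIntegral p q r x y := by
  refine intervalIntegral.integral_mono_on zero_le_one (intervalIntegrable_minIntegrand ..)
    (intervalIntegrable_minIntegrand ..) fun u hu => ?_
  refine mul_le_mul_of_nonneg_left ?_ (pow_nonneg hu.1 _)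
  exact mul_le_mul (sub_le_sub_left (maxCDF_mono q (by linarith)) _)
    (sub_le_sub_left (maxCDF_mono r (by linarith)) _) (sub_nonneg.2 (maxCDF_le_one _ _))
    (sub_nonneg.2 (maxCDF_le_one _ _))

theorem minIntegral_eq_zero (p q r : ℕ) {x : ℝ} (y : ℝ) (hx : 1 ≤ x) :
    minIntegral p q r x y = 0 := by
  unfold minIntegral
  rw [intervalIntegral.integral_congr (g := fun _ => (0 : ℝ))]
  · simp
  · intro u hu
    rw [Set.uIcc_of_le zero_le_one] at hu
    simp [maxCDF_of_one_le q (show 1 ≤ u + x by linarith [hu.1])]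

/-! ### Comparison of two maxima with equal shifts -/

/-- The difference of the (scaled) densities of the minimum-events of two maxima has a single sign
change. -/
theorem nonneg_of_le_of_nonneg {p q : ℕ} (hq : 1 ≤ q) (hpq : q ≤ p) {u v : ℝ} (hu : 0 ≤ u)
    (huv : u ≤ v) (hv : v ≤ 1)
    (h : 0 ≤ (p : ℝ) ^ 2 * u ^ (p - q) - q ^ 2 - (p ^ 2 - q ^ 2) * u ^ p) :
    0 ≤ (p : ℝ) ^ 2 * v ^ (p - q) - q ^ 2 - (p ^ 2 - q ^ 2) * v ^ p := by
  have hp : (0 : ℝ) < p := by exact_mod_cast (show 0 < p by omega)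
  -- In the variable a = u ^ p the expression is p² a^θ - q² - (p² - q²) a. It is concave and
  -- vanishes at a = 1, so once nonnegative it stays so up to 1.
  let θ : ℝ := (p - q : ℕ) / p
  have hθ : θ * p = (p - q : ℕ) := div_mul_cancel₀ _ hp.ne'
  have hθ0 : 0 ≤ θ := by positivity
  have hθ1 : θ ≤ 1 := (div_le_one hp).2 (by exact_mod_cast Nat.sub_le p q)
  have key : ∀ x : ℝ, 0 ≤ x → x ^ (p - q) = (x ^ p) ^ θ := fun x hx => by
    rw [← Real.rpow_natCast x p, ← Real.rpow_mul hx, mul_comm, hθ, Real.rpow_natCast]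
  have hconc := Real.concaveOn_rpow hθ0 hθ1
  have hup : u ^ p ≤ v ^ p := by gcongr
  have hvp : v ^ p ≤ 1 := pow_le_one₀ (hu.trans huv) hv
  rw [key u hu] at h
  rw [key v (hu.trans huv)]
  set a := u ^ p
  set b := v ^ p
  have ha : 0 ≤ a := pow_nonneg hu _
  rcases hup.eq_or_lt with hab | hab
  · rwa [← hab]
  have h1a : 0 < 1 - a := by linarith
  have := hconc.2 (Set.mem_Ici.2 ha) (Set.mem_Ici.2 zero_le_one)
    (show 0 ≤ (1 - b) / (1 - a) from div_nonneg (by linarith) h1a.le)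
    (show 0 ≤ (b - a) / (1 - a) from div_nonneg (by linarith) h1a.le)
    (by field_simp; ring)
  have hb : (1 - b) / (1 - a) * a + (b - a) / (1 - a) * 1 = b := by field_simp; ring
  simp only [smul_eq_mul, hb, Real.one_rpow] at this
  have hw : 0 ≤ (1 - b) / (1 - a) := div_nonneg (by linarith) h1a.le
  have hsum : (1 - b) / (1 - a) + (b - a) / (1 - a) = 1 := by field_simp; ring
  set w₁ := (1 - b) / (1 - a)
  set w₂ := (b - a) / (1 - a)
  have e1 := mul_le_mul_of_nonneg_left this (sq_nonneg (p : ℝ))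
  have e2 := mul_nonneg hw h
  have hw2 : w₂ = 1 - w₁ := by linarith
  rw [hw2] at e1 hb
  rw [← hb]
  rw [← hb] at e1
  nlinarith

/-- The bracket has integral zero and passes from negative to positive at a single point c.
Replacing `w` by the constant `w c` can only increase the integrand, and the resulting integral is
zero. -/
theorem integral_mul_antitone_nonpos {p q : ℕ} (hq : 1 ≤ q) (hpq : q ≤ p) {w : ℝ → ℝ}
    (hw : Antitone w) (hwc : Continuous w) :
    ∫ u in (0 : ℝ)..1, ((p : ℝ) ^ 2 * (u ^ (p - 1) * (1 - u ^ q)) -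
      q ^ 2 * (u ^ (q - 1) * (1 - u ^ p))) * w u ≤ 0 := by
  set h : ℝ → ℝ := fun u => (p : ℝ) ^ 2 * (u ^ (p - 1) * (1 - u ^ q)) -
      q ^ 2 * (u ^ (q - 1) * (1 - u ^ p)) with hh
  have hp0 : (p : ℝ) ≠ 0 := by
    have : p ≠ 0 := by omega
    exact_mod_cast this
  have hq0 : (q : ℝ) ≠ 0 := by
    have : q ≠ 0 := by omega
    exact_mod_cast this
  -- Each of the two terms integrates to pq / (p + q).
  have hint : ∫ u in (0 : ℝ)..1, h u = 0 := by
    have e : ∀ u, h u = (p : ℝ) ^ 2 * u ^ (p - 1) - p ^ 2 * u ^ (p + q - 1) -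
        (q ^ 2 * u ^ (q - 1) - q ^ 2 * u ^ (p + q - 1)) := fun u => by
      have e1 : p + q - 1 = (p - 1) + q := by omega
      have e2 : u ^ (p + q - 1) = u ^ (q - 1) * u ^ p := by
        rw [← pow_add]; congr 1; omega
      have e3 : u ^ (p + q - 1) = u ^ (p - 1) * u ^ q := by rw [e1, pow_add]
      simp only [hh]
      linear_combination p ^ 2 * e3 - q ^ 2 * e2
    simp only [e]
    have ii : ∀ (c : ℝ) (k : ℕ), IntervalIntegrable (fun u : ℝ => c * u ^ k) volume 0 1 :=
      fun c k => (by fun_prop : Continuous fun u : ℝ => c * u ^ k).intervalIntegrable 0 1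
    rw [intervalIntegral.integral_sub ((ii _ _).sub (ii _ _)) ((ii _ _).sub (ii _ _)),
      intervalIntegral.integral_sub (ii _ _) (ii _ _),
      intervalIntegral.integral_sub (ii _ _) (ii _ _)]
    simp only [intervalIntegral.integral_const_mul, integral_pow]
    rw [Nat.cast_sub (by omega), Nat.cast_sub (by omega), Nat.cast_sub (by omega)]
    have h0 : (p : ℝ) + q ≠ 0 := by positivity
    simp only [Nat.cast_one, Nat.cast_add, sub_add_cancel, one_pow]
    rw [zero_pow (by omega), zero_pow (by omega), zero_pow (by omega)]
    field_simp
    ring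
  have hfac : ∀ u, h u = u ^ (q - 1) *
      ((p : ℝ) ^ 2 * u ^ (p - q) - q ^ 2 - (p ^ 2 - q ^ 2) * u ^ p) := fun u => by
    have e1 : u ^ (p - 1) = u ^ (q - 1) * u ^ (p - q) := by rw [← pow_add]; congr 1; omega
    have e2 : u ^ p = u ^ (p - q) * u ^ q := by rw [← pow_add]; congr 1; omega
    simp only [hh]
    rw [e1, e2]
    ring
  -- The infimum of this set is the point of sign change.
  let S : Set ℝ :=
    {u | u ∈ Set.Icc (0 : ℝ) 1 ∧ 0 ≤ (p : ℝ) ^ 2 * u ^ (p - q) - q ^ 2 - (p ^ 2 - q ^ 2) * u ^ p}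
  have hS1 : (1 : ℝ) ∈ S := ⟨⟨zero_le_one, le_rfl⟩, by simp⟩
  have hSb : BddBelow S := ⟨0, fun u hu => hu.1.1⟩
  have hpt : ∀ u ∈ Set.Icc (0 : ℝ) 1, h u * w u ≤ h u * w (sInf S) := fun u hu => by
    rcases lt_trichotomy u (sInf S) with hlt | heq | hgt
    · have hn : u ∉ S := fun hu' => absurd (csInf_le hSb hu') (not_le.2 hlt)
      have : (p : ℝ) ^ 2 * u ^ (p - q) - q ^ 2 - (p ^ 2 - q ^ 2) * u ^ p ≤ 0 := by
        by_contra hc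
        exact hn ⟨hu, (not_le.1 hc).le⟩
      refine mul_le_mul_of_nonpos_left (hw hlt.le) ?_
      rw [hfac]
      exact mul_nonpos_of_nonneg_of_nonpos (pow_nonneg hu.1 _) this
    · rw [← heq]
    · obtain ⟨v, hv, hvu⟩ := exists_lt_of_csInf_lt ⟨1, hS1⟩ hgt
      refine mul_le_mul_of_nonneg_left (hw hgt.le) ?_
      rw [hfac]
      exact mul_nonneg (pow_nonneg hu.1 _)
        (nonneg_of_le_of_nonneg hq hpq hv.1.1 hvu.le hu.2 hv.2)
  have hc : Continuous h := by fun_prop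
  calc ∫ u in (0 : ℝ)..1, h u * w u ≤ ∫ u in (0 : ℝ)..1, h u * w (sInf S) :=
        intervalIntegral.integral_mono_on zero_le_one ((hc.mul hwc).intervalIntegrable 0 1)
          ((hc.mul continuous_const).intervalIntegrable 0 1) hpt
    _ = 0 := by rw [intervalIntegral.integral_mul_const, hint, zero_mul]

/-- This is the boundary inequality at gap 0: the decreasing weight is the factor contributed by the
third path. -/
theorem sq_mul_minIntegral_le {p q : ℕ} (r : ℕ) (hq : 1 ≤ q) (hpq : q ≤ p) (y : ℝ) :
    (p : ℝ) ^ 2 * minIntegral p q r 0 y ≤ q ^ 2 * minIntegral q p r 0 y := by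
  rw [← sub_nonpos]
  unfold minIntegral
  rw [← intervalIntegral.integral_const_mul, ← intervalIntegral.integral_const_mul,
    ← intervalIntegral.integral_sub ((intervalIntegrable_minIntegrand p q r 0 y).const_mul _)
      ((intervalIntegrable_minIntegrand q p r 0 y).const_mul _)]
  refine le_of_eq_of_le (intervalIntegral.integral_congr fun u hu => ?_)
    (integral_mul_antitone_nonpos hq hpq (w := fun u => 1 - maxCDF r (u + y))
      (fun u v huv => sub_le_sub_left (maxCDF_mono r (by linarith)) _)
      (by have := continuous_maxCDF r; fun_prop))
  rw [Set.uIcc_of_le zero_le_one] at hu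
  simp only [add_zero, maxCDF_of_mem hu.1 hu.2]
  ring

/-! ### The choice of the shifts -/

/-- The arguments of `minIntegral` are differences of the shifts 0, x, x + y given to the paths of
lengths p, q, r. Raising x favours the first path and hinders the second, which makes the first
difference monotone in x. -/
theorem exists_gaps {p q r : ℕ} (hr : 1 ≤ r) (hrq : r ≤ q) (hqp : q ≤ p) :
    ∃ x ∈ Set.Icc (0 : ℝ) 1, ∃ y ∈ Set.Icc (0 : ℝ) 1,
      (p : ℝ) ^ 2 * minIntegral p q r (-x) (-(x + y)) = q ^ 2 * minIntegral q p r x (-y) ∧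
      (q : ℝ) ^ 2 * minIntegral q p r x (-y) = r ^ 2 * minIntegral r p q (x + y) y := by
  let f : ℝ × ℝ → ℝ := fun z => (p : ℝ) ^ 2 * minIntegral p q r (-z.1) (-(z.1 + z.2)) -
    q ^ 2 * minIntegral q p r z.1 (-z.2)
  let g : ℝ × ℝ → ℝ := fun z => (q : ℝ) ^ 2 * minIntegral q p r z.1 (-z.2) -
    r ^ 2 * minIntegral r p q (z.1 + z.2) z.2
  have c0 : Continuous fun z : ℝ × ℝ => minIntegral p q r (-z.1) (-(z.1 + z.2)) :=
    (continuous_minIntegral p q r).comp (f := fun z : ℝ × ℝ => (-z.1, -(z.1 + z.2))) (by fun_prop)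
  have c1 : Continuous fun z : ℝ × ℝ => minIntegral q p r z.1 (-z.2) :=
    (continuous_minIntegral q p r).comp (f := fun z : ℝ × ℝ => (z.1, -z.2)) (by fun_prop)
  have c2 : Continuous fun z : ℝ × ℝ => minIntegral r p q (z.1 + z.2) z.2 :=
    (continuous_minIntegral r p q).comp (f := fun z : ℝ × ℝ => (z.1 + z.2, z.2)) (by fun_prop)
  have hfc : Continuous f := by fun_prop
  have hgc : Continuous g := by fun_prop
  obtain ⟨x, hx, y, hy, h1, h2⟩ := exists_common_zero_of_monotone hfc hgc
    (fun y _ x x' hxx' => sub_le_sub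
      (mul_le_mul_of_nonneg_left (minIntegral_anti p q r (by simpa using hxx')
        (by dsimp only; linarith)) (by positivity))
      (mul_le_mul_of_nonneg_left (minIntegral_anti q p r hxx' le_rfl) (by positivity)))
    (fun y _ => by
      have := sq_mul_minIntegral_le r (hr.trans hrq) hqp (-y)
      simpa [f] using this)
    (fun y _ => by
      simp only [f, minIntegral_eq_zero q p r _ le_rfl, mul_zero, sub_zero]
      exact mul_nonneg (by positivity) (minIntegral_nonneg ..))
    (fun x _ => by
      have := sq_mul_minIntegral_le p hr hrq x
      simp only [g, neg_zero, add_zero, sub_nonpos]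
      -- The swap moves the path with equal shift into the first slot, leaving the p-path as the
      -- weight.
      rwa [minIntegral_swap q p r, minIntegral_swap r p q])
    (fun x hx => by
      simp only [g, minIntegral_swap r p q, minIntegral_eq_zero r q p _ le_rfl, mul_zero, sub_zero]
      exact mul_nonneg (by positivity) (minIntegral_nonneg ..))
  exact ⟨x, hx, y, hy, sub_eq_zero.1 h1, sub_eq_zero.1 h2⟩

/-- Up to a factor, the probability that the `i`-th of three maxima of `n j` independent uniform
variables on `[a j, a j + 1]`, `j = 0, 1, 2`, is the smallest one. -/
noncomputable def smallestIntegral (n : Fin 3 → ℕ) (a : Fin 3 → ℝ) (i : Fin 3) : ℝ :=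
  ∫ u in (0 : ℝ)..1, u ^ (n i - 1) * ∏ j ∈ Finset.univ.erase i, (1 - maxCDF (n j) (u + (a i - a j)))

theorem smallestIntegral_comp_perm (n : Fin 3 → ℕ) (a : Fin 3 → ℝ) (σ : Equiv.Perm (Fin 3))
    (i : Fin 3) : smallestIntegral (n ∘ σ) (a ∘ σ) i = smallestIntegral n a (σ i) := by
  unfold smallestIntegral
  congr 1
  ext u
  congr 1
  refine Finset.prod_bij (fun j _ => σ j) ?_ ?_ ?_ ?_
  · intro j hj
    simpa using hj
  · intro j _ k _ h
    exact σ.injective h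
  · intro j hj
    exact ⟨σ.symm j, by simpa [Equiv.symm_apply_eq] using hj, by simp⟩
  · intro j _
    rfl

theorem exists_mem_shiftahedron (n : Fin 3 → ℕ) (hn : ∀ i, 1 ≤ n i) :
    ∃ a ∈ shiftahedron 3, ∀ i j,
      (n i : ℝ) ^ 2 * smallestIntegral n a i = (n j : ℝ) ^ 2 * smallestIntegral n a j := by
  -- Longest path first, so that the lengths are p ≥ q ≥ r and receive increasing shifts.
  obtain ⟨σ, hσ⟩ : ∃ σ : Equiv.Perm (Fin 3), Antitone (n ∘ σ) :=
    ⟨Tuple.sort (fun i => OrderDual.toDual (n i)), Tuple.monotone_sort (fun i => OrderDual.toDual (n i))⟩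
  obtain ⟨x, hx, y, hy, h1, h2⟩ := exists_gaps (hn (σ 2)) (hσ (show (1 : Fin 3) ≤ 2 by decide))
    (hσ (show (0 : Fin 3) ≤ 1 by decide))
  -- Only differences of shifts matter, so the lowest one is free to make the coordinate sum 3.
  let z : ℝ := (3 - 2 * x - y) / 3
  let v : Fin 3 → ℝ := ![z, z + x, z + x + y]
  have hv : v ∈ sortedShifts 3 := by
    refine ⟨?_, ?_⟩
    · have : Nat.choose 3 2 = 3 := rfl
      rw [this]
      simp [Fin.sum_univ_three, v, z]
      ring
    · intro i j hij
      have := hx.1; have := hx.2; have := hy.1; have := hy.2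
      fin_cases i <;> fin_cases j <;> simp at hij <;> simp [v] <;> constructor <;> linarith
  refine ⟨v ∘ σ.symm, ⟨v, hv, σ.symm, rfl⟩, ?_⟩
  have key : ∀ i, smallestIntegral n (v ∘ σ.symm) (σ i) = smallestIntegral (n ∘ σ) v i := fun i => by
    rw [← smallestIntegral_comp_perm]
    congr 1
    ext k
    simp
  have e0 : (Finset.univ.erase (0 : Fin 3)) = {1, 2} := by decide
  have e1 : (Finset.univ.erase (1 : Fin 3)) = {0, 2} := by decide
  have e2 : (Finset.univ.erase (2 : Fin 3)) = {0, 1} := by decide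
  have k0 : smallestIntegral (n ∘ σ) v 0 =
      minIntegral (n (σ 0)) (n (σ 1)) (n (σ 2)) (-x) (-(x + y)) := by
    unfold smallestIntegral minIntegral
    rw [e0]
    have d1 : v 0 - v 1 = -x := by simp [v]
    have d2 : v 0 - v 2 = -(x + y) := by simp [v]; ring
    simp [d1, d2]
  have k1 : smallestIntegral (n ∘ σ) v 1 =
      minIntegral (n (σ 1)) (n (σ 0)) (n (σ 2)) x (-y) := by
    unfold smallestIntegral minIntegral
    rw [e1]
    simp [v]
  have k2 : smallestIntegral (n ∘ σ) v 2 =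
      minIntegral (n (σ 2)) (n (σ 0)) (n (σ 1)) (x + y) y := by
    unfold smallestIntegral minIntegral
    rw [e2]
    simp [v, add_assoc]
  have hall : ∀ i, (n (σ i) : ℝ) ^ 2 * smallestIntegral n (v ∘ σ.symm) (σ i) =
      (n (σ 1) : ℝ) ^ 2 * smallestIntegral n (v ∘ σ.symm) (σ 1) := by
    intro i
    simp only [key]
    fin_cases i
    · simpa [k0, k1] using h1
    · rfl
    · simpa [k1, k2] using h2.symm
  intro i j
  have hi := hall (σ.symm i)
  have hj := hall (σ.symm j)
  rw [Equiv.apply_symm_apply] at hi hj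
  rw [hi, hj]

end RandomTrees

namespace RandomTrees

/-! ### Walks -/

section Walks

variable {α β : Type*} {G : Graph α β}

theorem IsWalk.append {x y z : α} {es fs : List β} (h : IsWalk G x es y) (h' : IsWalk G y fs z) :
    IsWalk G x (es ++ fs) z := by
  induction h with
  | nil _ => exact h'
  | cons hl _ ih => exact .cons hl (ih h')

theorem IsWalk.reverse {x y : α} {es : List β} (h : IsWalk G x es y) :
    IsWalk G y es.reverse x := by
  induction h with
  | nil hx => exact .nil hx
  | cons hl _ ih =>
    rw [List.reverse_cons]
    exact ih.append (.cons hl.symm (.nil hl.left_mem))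

theorem IsWalk.eq_of_nil {x y : α} (h : IsWalk G x [] y) : x = y := by
  cases h
  rfl

/-- A set of vertices that no edge of a walk leaves contains both ends of the walk or none. -/
theorem IsWalk.iff_of_forall {x y : α} {es : List β} (h : IsWalk G x es y) (U : α → Prop)
    (hU : ∀ e ∈ es, ∀ x y, G.IsLink e x y → (U x ↔ U y)) : U x ↔ U y := by
  induction h with
  | nil _ => rfl
  | cons hl _ ih =>
    exact (hU _ List.mem_cons_self _ _ hl).trans
      (ih fun e he => hU e (List.mem_cons_of_mem _ he))

theorem isConnected_of_forall_exists_walk {v : α} (hv : v ∈ G.vertexSet)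
    (h : ∀ x ∈ G.vertexSet, ∃ es : List β, IsWalk G x es v) : IsConnected G := by
  refine ⟨⟨v, hv⟩, fun x hx y hy => ?_⟩
  obtain ⟨es, hes⟩ := h x hx
  obtain ⟨fs, hfs⟩ := h y hy
  exact ⟨_, hes.append hfs.reverse⟩

/-- A graph is acyclic if each of its edges is a bridge. -/
theorem isAcyclic_of_forall_cut
    (h : ∀ e x y, G.IsLink e x y → ∃ U : α → Prop, ¬ (U x ↔ U y) ∧
      ∀ f, f ≠ e → ∀ x y, G.IsLink f x y → (U x ↔ U y)) : IsAcyclic G := by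
  intro x es hw hnd
  cases hw with
  | nil _ => rfl
  | @cons e _ y _ es hl hw =>
    obtain ⟨U, hne, hU⟩ := h _ _ _ hl
    refine absurd (hw.iff_of_forall U fun f hf => hU f ?_).symm hne
    rintro rfl
    exact (List.nodup_cons.1 hnd).1 hf

end Walks

/-! ### The spanning trees of theta graphs -/

section Theta

variable {r s t : ℕ}

/-- A choice of one edge on each of the three paths. -/
abbrev EdgeChoice (r s t : ℕ) : Type := ∀ i : Fin 3, Fin (pathLength r s t i)

/-- All the edges except for the chosen ones on the two paths other than the `i`-th path. -/
def treeOf (m : EdgeChoice r s t) (i : Fin 3) : Finset (ThetaEdge r s t) :=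
  Finset.univ.filter fun e => e.1 = i ∨ e.2 ≠ m e.1

theorem mem_treeOf {m : EdgeChoice r s t} {i : Fin 3} {e : ThetaEdge r s t} :
    e ∈ treeOf m i ↔ (e.1 = i ∨ e.2 ≠ m e.1) := by
  simp [treeOf]

theorem pathVertex_zero (i : Fin 3) : pathVertex r s t i 0 = .left := by simp [pathVertex]

theorem pathVertex_length (i : Fin 3) (hi : 1 ≤ pathLength r s t i) :
    pathVertex r s t i (pathLength r s t i) = .right := by
  simp [pathVertex, show pathLength r s t i ≠ 0 by omega]

theorem pathVertex_succ (i : Fin 3) (k : Fin (pathLength r s t i - 1)) :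
    pathVertex r s t i (k + 1) = .inner i k := by
  have := k.2
  simp [pathVertex, show (k : ℕ) + 1 < pathLength r s t i by omega]

/-- The vertices in front of the chosen edges, as seen from the left base vertex. -/
def leftOf (m : EdgeChoice r s t) : ThetaVertex r s t → Prop
  | .left => True
  | .right => False
  | .inner i k => (k : ℕ) + 1 ≤ m i

theorem leftOf_pathVertex (m : EdgeChoice r s t) (i : Fin 3) (k : ℕ) :
    leftOf m (pathVertex r s t i k) ↔ k ≤ m i := by
  have := (m i).2
  unfold pathVertex
  split_ifs with h0 h1
  · simp [leftOf, h0]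
  · simp only [leftOf]
    omega
  · simp only [leftOf, false_iff]
    omega

/-- The vertices of the `i`-th path after its `c`-th edge and in front of its `d`-th edge. -/
def between (r s t : ℕ) (i : Fin 3) (c d : ℕ) : ThetaVertex r s t → Prop
  | .left => False
  | .right => False
  | .inner j k => j = i ∧ c < (k : ℕ) + 1 ∧ (k : ℕ) + 1 ≤ d

theorem between_pathVertex {i : Fin 3} {c d : ℕ} (hd : d < pathLength r s t i) (j : Fin 3) (k : ℕ) :
    between r s t i c d (pathVertex r s t j k) ↔ j = i ∧ c < k ∧ k ≤ d := by
  unfold pathVertex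
  split_ifs with h0 h1
  · simp [between, h0]
  · simp only [between]
    rw [show k - 1 + 1 = k by omega]
  · simp only [between, false_iff]
    rintro ⟨rfl, h⟩
    omega

theorem iff_of_isLink {e : ThetaEdge r s t} {x y : ThetaVertex r s t} (h : (theta r s t).IsLink e x y)
    (U : ThetaVertex r s t → Prop) :
    (U x ↔ U y) ↔ (U (pathVertex r s t e.1 e.2) ↔ U (pathVertex r s t e.1 (e.2 + 1))) := by
  have h' : s(x, y) = s(pathVertex r s t e.1 (e.2 : ℕ), pathVertex r s t e.1 ((e.2 : ℕ) + 1)) := h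
  rw [Sym2.eq_iff] at h'
  rcases h' with ⟨rfl, rfl⟩ | ⟨rfl, rfl⟩
  · rfl
  · exact Iff.comm

theorem leftOf_iff_of_isLink (m : EdgeChoice r s t) {e : ThetaEdge r s t} {x y : ThetaVertex r s t}
    (h : (theta r s t).IsLink e x y) : (leftOf m x ↔ leftOf m y) ↔ e.2 ≠ m e.1 := by
  rw [iff_of_isLink h, leftOf_pathVertex, leftOf_pathVertex, ne_eq, Fin.ext_iff]
  omega

theorem between_iff_of_isLink {i : Fin 3} {c d : ℕ} (hcd : c < d) (hd : d < pathLength r s t i)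
    {e : ThetaEdge r s t} {x y : ThetaVertex r s t} (h : (theta r s t).IsLink e x y) :
    (between r s t i c d x ↔ between r s t i c d y) ↔
      ¬ (e.1 = i ∧ ((e.2 : ℕ) = c ∨ (e.2 : ℕ) = d)) := by
  rw [iff_of_isLink h, between_pathVertex hd, between_pathVertex hd]
  by_cases hi : e.1 = i
  · simp only [hi, true_and]
    omega
  · simp [hi]

/-- The record of the edges used serves to close two whole paths into a cycle with distinct edges.
-/
theorem exists_walk_pathVertex (T : Set (ThetaEdge r s t)) (i : Fin 3) (k l : ℕ) (hkl : k ≤ l)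
    (hl : l ≤ pathLength r s t i)
    (hT : ∀ c : Fin (pathLength r s t i), k ≤ c → (c : ℕ) < l → (⟨i, c⟩ : ThetaEdge r s t) ∈ T) :
    ∃ es, IsWalk ((theta r s t).restrict T) (pathVertex r s t i k) es (pathVertex r s t i l) ∧
      es.Nodup ∧ ∀ e ∈ es, e.1 = i ∧ (e.2 : ℕ) < l := by
  induction l, hkl using Nat.le_induction with
  | base => exact ⟨[], .nil (Set.mem_univ _), List.nodup_nil, by simp⟩
  | succ l hkl ih =>
    obtain ⟨es, hw, hnd, hes⟩ := ih (by omega) fun c h1 h2 => hT c h1 (by omega)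
    refine ⟨es ++ [⟨i, ⟨l, by omega⟩⟩], hw.append (.cons ?_ (.nil (Set.mem_univ _))), ?_, ?_⟩
    · exact ⟨hT ⟨l, by omega⟩ hkl (by simp), rfl⟩
    · refine List.nodup_append.2 ⟨hnd, by simp, ?_⟩
      rintro e he f hf rfl
      rw [List.mem_singleton] at hf
      have := (hes e he).2
      subst hf
      simp at this
    · intro e he
      rcases List.mem_append.1 he with he | he
      · exact ⟨(hes e he).1, (hes e he).2.trans (by omega)⟩
      · rw [List.mem_singleton] at he
        subst he
        simp

theorem isSpanningTree_treeOf (m : EdgeChoice r s t) (i : Fin 3) :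
    IsSpanningTree (theta r s t) (treeOf m i) := by
  have hpos : ∀ i, 1 ≤ pathLength r s t i := fun i => by have := (m i).2; omega
  refine ⟨fun _ _ => Set.mem_univ _, ?_, ?_⟩
  · have toLeft : ∀ j (k : ℕ), (j = i ∧ k ≤ pathLength r s t j) ∨ k ≤ m j →
        ∃ es, IsWalk ((theta r s t).restrict (treeOf m i : Set _)) (pathVertex r s t j k) es .left := by
      intro j k hk
      obtain ⟨es, hw, -⟩ := exists_walk_pathVertex (treeOf m i : Set (ThetaEdge r s t)) j 0 k (Nat.zero_le _)
        (by have := (m j).2; omega) fun c _ hc => by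
          rw [Finset.mem_coe, mem_treeOf]
          rcases hk with hk | hk
          · exact Or.inl hk.1
          · refine Or.inr fun h => ?_
            simp only at h
            subst h
            omega
      exact ⟨_, pathVertex_zero (r := r) (s := s) (t := t) j ▸ hw.reverse⟩
    have toRight : ∀ j (k : ℕ), (m j : ℕ) < k → k ≤ pathLength r s t j →
        ∃ es, IsWalk ((theta r s t).restrict (treeOf m i : Set _)) (pathVertex r s t j k) es .right := by
      intro j k hk hkl
      obtain ⟨es, hw, -⟩ := exists_walk_pathVertex (treeOf m i : Set (ThetaEdge r s t)) j k (pathLength r s t j)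
        hkl le_rfl fun c hc _ => by
          rw [Finset.mem_coe, mem_treeOf]
          refine Or.inr fun h => ?_
          simp only at h
          subst h
          omega
      exact ⟨_, pathVertex_length j (hpos j) ▸ hw⟩
    obtain ⟨es₀, h₀⟩ := toLeft i _ (Or.inl ⟨rfl, le_rfl⟩)
    rw [pathVertex_length i (hpos i)] at h₀
    have hall : ∀ j (k : ℕ), k ≤ pathLength r s t j →
        ∃ es, IsWalk ((theta r s t).restrict (treeOf m i : Set _)) (pathVertex r s t j k) es .left := by
      intro j k hk
      rcases le_or_gt k (m j) with h | h
      · exact toLeft j k (Or.inr h)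
      · obtain ⟨es, hes⟩ := toRight j k h hk
        exact ⟨_, hes.append h₀⟩
    refine isConnected_of_forall_exists_walk (v := .left) (Set.mem_univ _) fun x _ => ?_
    match x with
    | .left => exact ⟨[], .nil (Set.mem_univ _)⟩
    | .right => exact ⟨_, h₀⟩
    | .inner j k =>
      rw [← pathVertex_succ]
      exact hall j _ (by have := k.2; omega)
  · refine isAcyclic_of_forall_cut fun e x y hl => ?_
    have he : e.1 = i ∨ e.2 ≠ m e.1 := mem_treeOf.1 hl.1
    by_cases hi : e.1 = i
    · obtain ⟨i', c⟩ := e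
      dsimp only at hi
      subst hi
      -- Cutting the whole path at this edge, together with the two omitted edges, separates the
      -- base vertices.
      refine ⟨leftOf (Function.update m i' c), ?_, fun f hf x y hl' => ?_⟩
      · rw [leftOf_iff_of_isLink _ hl.2]
        simp
      · rw [leftOf_iff_of_isLink _ hl'.2]
        obtain ⟨j, d⟩ := f
        have hf' := mem_treeOf.1 hl'.1
        by_cases hj : j = i'
        · subst hj
          simpa using hf
        · simpa [hj] using hf'
    · have hne : e.2 ≠ m e.1 := he.resolve_left hi
      have hne' : (e.2 : ℕ) ≠ m e.1 := fun h => hne (Fin.ext h)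
      have hlt : min (e.2 : ℕ) (m e.1) < max (e.2 : ℕ) (m e.1) := by omega
      have hmax : max (e.2 : ℕ) (m e.1) < pathLength r s t e.1 := max_lt e.2.2 (m e.1).2
      -- On a path with an omitted edge, the segment between that edge and this one is cut off by
      -- the two of them.
      refine ⟨between r s t e.1 (min (e.2 : ℕ) (m e.1)) (max (e.2 : ℕ) (m e.1)), ?_, fun f hf x y hl' => ?_⟩
      · rw [between_iff_of_isLink hlt hmax hl.2]
        simp only [not_not, true_and]
        omega
      · rw [between_iff_of_isLink hlt hmax hl'.2]
        rintro ⟨h1, h2⟩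
        have hf' := mem_treeOf.1 hl'.1
        obtain ⟨j, d⟩ := f
        dsimp only at h1
        subst h1
        have : (d : ℕ) ≠ e.2 := fun h => hf (by rw [Fin.ext h])
        have : (d : ℕ) ≠ m e.1 := fun h => (hf'.resolve_left hi) (Fin.ext h)
        simp only at h2
        omega

/-- Two edges missing from one path would isolate the segment between them; an edge missing from
every path would separate the base vertices; two whole paths would form a cycle. -/
theorem exists_eq_treeOf (hpos : ∀ i, 1 ≤ pathLength r s t i) {T : Finset (ThetaEdge r s t)}
    (hT : IsSpanningTree (theta r s t) T) : ∃ m i, T = treeOf m i := by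
  obtain ⟨-, ⟨-, hconn⟩, hacyc⟩ := hT
  have hsub : ∀ i (c d : Fin (pathLength r s t i)), (⟨i, c⟩ : ThetaEdge r s t) ∉ T →
      (⟨i, d⟩ : ThetaEdge r s t) ∉ T → ¬ c < d := by
    intro i c d hc hd hcd
    obtain ⟨es, hw⟩ := hconn (pathVertex r s t i d) (Set.mem_univ _) .left (Set.mem_univ _)
    have := hw.iff_of_forall (between r s t i c d) fun e _ x y hl => by
      rw [between_iff_of_isLink hcd d.2 hl.2]
      rintro ⟨h1, h2⟩
      obtain ⟨j, e⟩ := e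
      dsimp only at h1
      subst h1
      rcases h2 with h2 | h2
      · exact hc (Fin.ext h2 ▸ hl.1)
      · exact hd (Fin.ext h2 ▸ hl.1)
    rw [between_pathVertex d.2] at this
    exact this.1 ⟨rfl, hcd, le_rfl⟩
  have huniq : ∀ i (c d : Fin (pathLength r s t i)), (⟨i, c⟩ : ThetaEdge r s t) ∉ T →
      (⟨i, d⟩ : ThetaEdge r s t) ∉ T → c = d := fun i c d hc hd =>
    le_antisymm (not_lt.1 (hsub i d c hd hc)) (not_lt.1 (hsub i c d hc hd))
  have hfull : ∃ i, ∀ c : Fin (pathLength r s t i), (⟨i, c⟩ : ThetaEdge r s t) ∈ T := by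
    by_contra! h
    choose m hm using h
    obtain ⟨es, hw⟩ := hconn .left (Set.mem_univ _) .right (Set.mem_univ _)
    have := hw.iff_of_forall (leftOf m) fun e _ x y hl => by
      rw [leftOf_iff_of_isLink _ hl.2]
      intro he
      obtain ⟨j, e⟩ := e
      dsimp only at he
      subst he
      exact hm j hl.1
    exact this.1 trivial
  obtain ⟨i, hi⟩ := hfull
  have hother : ∀ j, ∃ c : Fin (pathLength r s t j), j ≠ i → (⟨j, c⟩ : ThetaEdge r s t) ∉ T := by
    intro j
    by_cases hji : j = i
    -- The choice on the whole path is a dummy, since `treeOf` ignores it.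
    · exact ⟨⟨0, hpos j⟩, fun h => absurd hji h⟩
    by_contra! hj
    obtain ⟨es, hes, hend, hei⟩ := exists_walk_pathVertex (T : Set (ThetaEdge r s t)) i 0 _ (Nat.zero_le _) le_rfl
      fun c _ _ => hi c
    obtain ⟨fs, hfs, hfnd, hfj⟩ := exists_walk_pathVertex (T : Set (ThetaEdge r s t)) j 0 _ (Nat.zero_le _) le_rfl
      fun c _ _ => (hj c).2
    rw [pathVertex_zero, pathVertex_length _ (hpos _)] at hes hfs
    have := hacyc _ _ (hes.append hfs.reverse) (List.nodup_append.2
      ⟨hend, List.nodup_reverse.2 hfnd, fun e he f hf hef => hji (by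
        rw [← (hei e he).1, hef, (hfj f (List.mem_reverse.1 hf)).1])⟩)
    rw [List.append_eq_nil_iff] at this
    rw [this.1] at hes
    exact ThetaVertex.noConfusion rfl rfl rfl (heq_of_eq hes.eq_of_nil)
  choose m hm using hother
  refine ⟨m, i, ?_⟩
  ext ⟨j, c⟩
  rw [mem_treeOf]
  by_cases hj : j = i
  · subst hj
    simp [hi c]
  · simp only [hj, false_or]
    refine ⟨fun h hc => hm j hj (hc ▸ h), fun h => ?_⟩
    by_contra hc
    exact h (huniq j c (m j) hc (hm j hj))

end Theta

end RandomTrees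

namespace RandomTrees

/-! ### The minimum spanning tree of a theta graph -/

section MST

variable {r s t : ℕ}

/-- The chosen edges are the heaviest ones of their paths, and the one on the `i`-th path is the
lightest of the three. -/
def cell (m : EdgeChoice r s t) (i : Fin 3) : Set (ThetaEdge r s t → ℝ) :=
  {w | (∀ j, ∀ k, k ≠ m j → w ⟨j, k⟩ < w ⟨j, m j⟩) ∧ ∀ j, j ≠ i → w ⟨i, m i⟩ < w ⟨j, m j⟩}

theorem sum_treeOf (w : ThetaEdge r s t → ℝ) (m : EdgeChoice r s t) (i : Fin 3) :
    ∑ e ∈ treeOf m i, w e = ∑ e, w e - (∑ j, w ⟨j, m j⟩ - w ⟨i, m i⟩) := by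
  have hinj : Function.Injective fun j : Fin 3 => (⟨j, m j⟩ : ThetaEdge r s t) := fun j k h =>
    congrArg Sigma.fst h
  have htree : treeOf m i = Finset.univ \ (Finset.univ.erase i).image
      fun j => (⟨j, m j⟩ : ThetaEdge r s t) := by
    ext ⟨j, c⟩
    simp only [mem_treeOf, Finset.mem_sdiff, Finset.mem_univ, true_and, Finset.mem_image,
      Finset.mem_erase, and_true, not_exists, not_and]
    constructor
    · rintro h k hk he
      cases he
      exact h.elim hk fun h => h rfl
    · intro h
      by_contra! hc
      exact h j hc.1 (by rw [hc.2])
  rw [htree, Finset.sum_sdiff_eq_sub (Finset.subset_univ _), Finset.sum_image hinj.injOn,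
    Finset.sum_erase_eq_sub (Finset.mem_univ i)]

theorem eq_of_treeOf_eq {m m' : EdgeChoice r s t} {i i' : Fin 3} (h : treeOf m i = treeOf m' i') :
    i = i' ∧ ∀ j, j ≠ i → m j = m' j := by
  have key : ∀ j, j ≠ i → j ≠ i' ∧ m j = m' j := fun j hj => by
    have h1 : (⟨j, m j⟩ : ThetaEdge r s t) ∉ treeOf m i := by simp [mem_treeOf, hj]
    rw [h, mem_treeOf] at h1
    push Not at h1
    exact h1
  refine ⟨?_, fun j hj => (key j hj).2⟩
  by_contra hne
  exact (key i' (Ne.symm hne)).1 rfl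

theorem treeOf_congr {m m' : EdgeChoice r s t} {i : Fin 3} (h : ∀ j, j ≠ i → m j = m' j) :
    treeOf m i = treeOf m' i := by
  ext e
  rw [mem_treeOf, mem_treeOf]
  by_cases hi : e.1 = i
  · simp [hi]
  · simp [hi, h _ hi]

/-- `treeOf m i` as a spanning tree. -/
def spanningTreeOf (m : EdgeChoice r s t) (i : Fin 3) : SpanningTree (theta r s t) :=
  ⟨treeOf m i, isSpanningTree_treeOf m i⟩

theorem exists_eq_spanningTreeOf (hpos : ∀ i, 1 ≤ pathLength r s t i)
    (T : SpanningTree (theta r s t)) : ∃ m i, T = spanningTreeOf m i := by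
  obtain ⟨m, i, h⟩ := exists_eq_treeOf hpos T.2
  exact ⟨m, i, Subtype.ext h⟩

/-- Minimal tree weight means maximal omitted weight, and the best two edges on distinct paths are
the two larger path maxima. -/
theorem isMST_of_mem_cell (hpos : ∀ i, 1 ≤ pathLength r s t i) {w : ThetaEdge r s t → ℝ}
    {m : EdgeChoice r s t} {i : Fin 3} (hw : w ∈ cell m i) :
    IsMST (theta r s t) w (spanningTreeOf m i) := by
  intro T' hT'
  obtain ⟨m', i', rfl⟩ := exists_eq_spanningTreeOf hpos T'
  obtain ⟨htop, hmin⟩ := hw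
  have hle : ∀ j, w ⟨j, m' j⟩ ≤ w ⟨j, m j⟩ := fun j => by
    by_cases h : m' j = m j
    · rw [h]
    · exact (htop j _ h).le
  have hsub : ∀ (v : Fin 3 → ℝ) (k : Fin 3), ∑ j, v j - v k = ∑ j ∈ Finset.univ.erase k, v j :=
    fun v k => (Finset.sum_erase_eq_sub (Finset.mem_univ k)).symm
  change ∑ e ∈ treeOf m i, w e < ∑ e ∈ treeOf m' i', w e
  rw [sum_treeOf, sum_treeOf, sub_lt_sub_iff_left]
  have h1 : ∑ j, w ⟨j, m' j⟩ - w ⟨i', m' i'⟩ ≤ ∑ j, w ⟨j, m j⟩ - w ⟨i', m i'⟩ := by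
    rw [hsub (fun j => w ⟨j, m' j⟩), hsub (fun j => w ⟨j, m j⟩)]
    exact Finset.sum_le_sum fun j _ => hle j
  by_cases hi : i' = i
  · subst hi
    obtain ⟨j, hj, hne⟩ : ∃ j, j ≠ i' ∧ m' j ≠ m j := by
      by_contra! hc
      exact hT' (Subtype.ext (treeOf_congr hc))
    rw [hsub (fun j => w ⟨j, m' j⟩), hsub (fun j => w ⟨j, m j⟩)]
    exact Finset.sum_lt_sum (fun j _ => hle j)
      ⟨j, Finset.mem_erase.2 ⟨hj, Finset.mem_univ _⟩, htop j _ hne⟩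
  · have := hmin i' hi
    linarith

theorem exists_mem_cell (hpos : ∀ i, 1 ≤ pathLength r s t i) {w : ThetaEdge r s t → ℝ}
    (hw : Function.Injective w) : ∃ m i, w ∈ cell m i := by
  have hmax : ∀ j, ∃ c : Fin (pathLength r s t j), ∀ k, w ⟨j, k⟩ ≤ w ⟨j, c⟩ := fun j => by
    have : Nonempty (Fin (pathLength r s t j)) := ⟨⟨0, hpos j⟩⟩
    exact Finite.exists_max fun k => w ⟨j, k⟩
  choose m hm using hmax
  obtain ⟨i, hi⟩ := Finite.exists_min fun j => w ⟨j, m j⟩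
  refine ⟨m, i, fun j k hk => (hm j k).lt_of_ne fun h => hk ?_,
    fun j hj => (hi j).lt_of_ne fun h => hj ?_⟩
  · have := hw h
    simpa using this
  · exact (congrArg Sigma.fst (hw h)).symm

theorem IsMST.unique {α β : Type*} {G : Graph α β} {w : β → ℝ} {T T' : SpanningTree G}
    (h : IsMST G w T) (h' : IsMST G w T') : T = T' := by
  by_contra hne
  exact lt_asymm (h T' (Ne.symm hne)) (h' T hne)

/-- A tree does not determine the heaviest edge `g` of its whole path, so its event is a union of
cells over `g`. -/
theorem isMST_iff (hpos : ∀ i, 1 ≤ pathLength r s t i) {w : ThetaEdge r s t → ℝ}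
    (hw : Function.Injective w) (m : EdgeChoice r s t) (i : Fin 3) :
    IsMST (theta r s t) w (spanningTreeOf m i) ↔ ∃ g, w ∈ cell (Function.update m i g) i := by
  constructor
  · intro h
    obtain ⟨m', i', hc⟩ := exists_mem_cell hpos hw
    have heq := congrArg Subtype.val (h.unique (isMST_of_mem_cell hpos hc))
    obtain ⟨rfl, hm⟩ := eq_of_treeOf_eq heq
    refine ⟨m' i, ?_⟩
    convert hc
    ext j
    by_cases hj : j = i
    · subst hj; simp
    · simp [hj, hm j hj]
  · rintro ⟨g, hg⟩
    have : spanningTreeOf m i = spanningTreeOf (Function.update m i g) i :=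
      Subtype.ext (treeOf_congr fun j hj => by simp [hj])
    rw [this]
    exact isMST_of_mem_cell hpos hg

theorem disjoint_cell_update (m : EdgeChoice r s t) (i : Fin 3) :
    Pairwise (Function.onFun Disjoint fun g => cell (Function.update m i g) i) := by
  intro g g' hne
  rw [Function.onFun, Set.disjoint_left]
  intro w hw hw'
  have h1 := hw.1 i g' (by simpa using hne.symm)
  have h2 := hw'.1 i g (by simpa using hne)
  simp only [Function.update_self] at h1 h2
  exact lt_asymm h1 h2

theorem measurableSet_cell (m : EdgeChoice r s t) (i : Fin 3) : MeasurableSet (cell m i) := by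
  unfold cell
  measurability

theorem measurableSet_isMST (T : SpanningTree (theta r s t)) :
    MeasurableSet {w | IsMST (theta r s t) w T} := by
  simp only [IsMST, Set.ofPred_forall]
  refine MeasurableSet.iInter fun T' => MeasurableSet.iInter fun _ => measurableSet_lt ?_ ?_ <;>
  fun_prop

end MST

/-! ### The law of the weights -/

instance isProbabilityMeasure_Icc (a : ℝ) :
    IsProbabilityMeasure (volume.restrict (Set.Icc a (a + 1))) := ⟨by simp⟩

instance isProbabilityMeasure_shiftedWeights {β : Type*} [Fintype β] (S : β → ℝ) :
    IsProbabilityMeasure (shiftedWeights S) := by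
  unfold shiftedWeights
  infer_instance

/-- Ties between two given edges form a proper subspace, which is Lebesgue-null. -/
theorem ae_injective_shiftedWeights {β : Type*} [Fintype β] (S : β → ℝ) :
    ∀ᵐ w ∂shiftedWeights S, Function.Injective w := by
  have hac : shiftedWeights S ≪ volume := by
    unfold shiftedWeights
    rw [← Measure.restrict_pi_pi, ← volume_pi]
    exact Measure.absolutelyContinuous_of_le Measure.restrict_le_self
  refine hac.ae_le ?_
  have key : ∀ e f : β, e ≠ f → ∀ᵐ w : β → ℝ, w e ≠ w f := by
    classical
    intro e f hef
    let V : Submodule ℝ (β → ℝ) := LinearMap.ker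
      (LinearMap.proj (R := ℝ) (φ := fun _ : β => ℝ) e - LinearMap.proj f)
    have hV : V ≠ ⊤ := fun h => by
      have : Pi.single e (1 : ℝ) ∈ V := h ▸ Submodule.mem_top
      simp [V, hef.symm] at this
    refine measure_mono_null (fun w hw => ?_) (Measure.addHaar_submodule volume V hV)
    simpa [V, sub_eq_zero] using hw
  have : ∀ᵐ w : β → ℝ, ∀ e f : β, e ≠ f → w e ≠ w f := by
    rw [ae_all_iff]; intro e
    rw [ae_all_iff]; intro f
    rw [ae_all_iff]; exact key e f
  filter_upwards [this] with w hw e f h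
  by_contra hne
  exact hw e f hne h

theorem sum_isMST_eq_one {r s t : ℕ} (hpos : ∀ i, 1 ≤ pathLength r s t i)
    [Fintype (SpanningTree (theta r s t))] (S : ThetaEdge r s t → ℝ) :
    ∑ T, shiftedMST (theta r s t) S T = 1 := by
  unfold shiftedMST
  rw [← measureReal_iUnion_fintype (fun T T' hne => ?_) measurableSet_isMST]
  · have : (⋃ T, {w | IsMST (theta r s t) w T}) =ᵐ[shiftedWeights S] Set.univ := by
      rw [Filter.eventuallyEq_univ]
      filter_upwards [ae_injective_shiftedWeights S] with w hw
      obtain ⟨m, i, hc⟩ := exists_mem_cell hpos hw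
      exact Set.mem_iUnion.2 ⟨_, isMST_of_mem_cell hpos hc⟩
    rw [measureReal_congr this, probReal_univ]
  · rw [Function.onFun, Set.disjoint_left]
    exact fun w h h' => hne (h.unique h')

theorem shiftedMST_spanningTreeOf {r s t : ℕ} (hpos : ∀ i, 1 ≤ pathLength r s t i)
    (S : ThetaEdge r s t → ℝ) (m : EdgeChoice r s t) (i : Fin 3) :
    shiftedMST (theta r s t) S (spanningTreeOf m i) =
      ∑ g, (shiftedWeights S).real (cell (Function.update m i g) i) := by
  rw [← measureReal_iUnion_fintype (disjoint_cell_update m i) fun g => measurableSet_cell _ i]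
  refine measureReal_congr ?_
  filter_upwards [ae_injective_shiftedWeights S] with w hw
  refine propext ((isMST_iff hpos hw m i).trans ?_)
  exact Set.mem_iUnion.symm

end RandomTrees

namespace RandomTrees

/-! ### The law of the heaviest edge of a path -/

/-- The law of the weight of the heaviest edge of a path of length `n`, restricted to the event that
the heaviest edge is a given one. -/
noncomputable def topLaw (n : ℕ) (a : ℝ) : Measure ℝ :=
  (volume.restrict (Set.Icc a (a + 1))).withDensity
    fun x => ENNReal.ofReal (maxCDF (n - 1) (x - a))

theorem continuous_maxCDF_sub (n : ℕ) (a : ℝ) : Continuous fun x => maxCDF n (x - a) :=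
  (continuous_maxCDF n).comp (by fun_prop)

theorem maxCDF_nonneg (n : ℕ) (v : ℝ) : 0 ≤ maxCDF n v := pow_nonneg (le_max_left _ _) _

instance isFiniteMeasure_topLaw (n : ℕ) (a : ℝ) : IsFiniteMeasure (topLaw n a) := by
  refine isFiniteMeasure_withDensity (ne_of_lt ?_)
  calc ∫⁻ x in Set.Icc a (a + 1), ENNReal.ofReal (maxCDF (n - 1) (x - a))
      ≤ ∫⁻ x in Set.Icc a (a + 1), 1 :=
        lintegral_mono fun x => ENNReal.ofReal_le_one.2 (maxCDF_le_one _ _)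
    _ < ⊤ := by simp

theorem restrict_Icc_Iio (a x : ℝ) :
    volume.restrict (Set.Icc a (a + 1)) (Set.Iio x) = ENNReal.ofReal (max 0 (min (x - a) 1)) := by
  rw [Measure.restrict_congr_set (Ico_ae_eq_Icc (μ := volume) (a := a) (b := a + 1)).symm,
    Measure.restrict_apply measurableSet_Iio, Set.inter_comm, Set.Ico_inter_Iio, Real.volume_Ico]
  rw [← min_sub_sub_right, add_sub_cancel_left, min_comm, ENNReal.ofReal_max]
  simp

/-- Split off the coordinate `m`: given its value x, the other n - 1 independent coordinates lie
below x with probability `maxCDF (n - 1) (x - a)`. -/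
theorem map_eval_restrict_pi {n : ℕ} (m : Fin n) (a : ℝ) :
    ((Measure.pi fun _ : Fin n => volume.restrict (Set.Icc a (a + 1))).restrict
      {w | ∀ k, k ≠ m → w k < w m}).map (fun w => w m) = topLaw n a := by
  obtain ⟨n, rfl⟩ : ∃ k, n = k + 1 := ⟨n - 1, by have := m.2; omega⟩
  have htop : MeasurableSet {w : Fin (n + 1) → ℝ | ∀ k, k ≠ m → w k < w m} := by measurability
  ext B hB
  rw [Measure.map_apply (by fun_prop) hB, Measure.restrict_apply (measurable_pi_apply m hB)]
  have hset : (fun w : Fin (n + 1) → ℝ => w m) ⁻¹' B ∩ {w | ∀ k, k ≠ m → w k < w m} =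
      MeasurableEquiv.piFinSuccAbove (fun _ => ℝ) m ⁻¹' {p | p.1 ∈ B ∧ ∀ k, p.2 k < p.1} := by
    ext w
    simp only [Set.mem_inter_iff, Set.mem_preimage, Set.mem_ofPred_eq,
      MeasurableEquiv.piFinSuccAbove_apply, Fin.insertNthEquiv_symm_apply]
    refine and_congr_right fun _ => ⟨fun h k => h _ (Fin.succAbove_ne m k), fun h k hk => ?_⟩
    obtain ⟨l, rfl⟩ := Fin.exists_succAbove_eq hk
    exact h l
  have hmeas : MeasurableSet {p : ℝ × (Fin n → ℝ) | p.1 ∈ B ∧ ∀ k, p.2 k < p.1} := by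
    have : MeasurableSet {p : ℝ × (Fin n → ℝ) | ∀ k, p.2 k < p.1} := by measurability
    exact (measurable_fst hB).inter this
  rw [hset, (measurePreserving_piFinSuccAbove (fun _ => volume.restrict (Set.Icc a (a + 1)))
    m).measure_preimage hmeas.nullMeasurableSet, Measure.prod_apply hmeas, topLaw,
    withDensity_apply _ hB, ← lintegral_indicator hB]
  refine lintegral_congr fun x => ?_
  by_cases hx : x ∈ B
  · have : Prod.mk x ⁻¹' {p : ℝ × (Fin n → ℝ) | p.1 ∈ B ∧ ∀ k, p.2 k < p.1} =
        Set.univ.pi fun _ => Set.Iio x := by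
      ext v
      simp [hx]
    rw [this, Measure.pi_pi]
    simp only [restrict_Icc_Iio, Finset.prod_const, Finset.card_univ, Fintype.card_fin]
    simp [hx, maxCDF, ENNReal.ofReal_pow]
  · simp [hx]

theorem topLaw_Ioi {n : ℕ} (hn : 1 ≤ n) (a x : ℝ) :
    topLaw n a (Set.Ioi x) = ENNReal.ofReal ((1 - maxCDF n (x - a)) / n) := by
  -- Clamping x to the interval makes the density a plain power on the range of integration.
  let y := max a (min x (a + 1))
  have hy1 : a ≤ y := le_max_left _ _
  have hy2 : y ≤ a + 1 := max_le (by linarith) (min_le_right _ _)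
  have hset : Set.Ioi x ∩ Set.Ioc a (a + 1) = Set.Ioc y (a + 1) := by
    ext z
    simp only [Set.mem_inter_iff, Set.mem_Ioi, Set.mem_Ioc, y, max_lt_iff, min_lt_iff]
    constructor
    · rintro ⟨h1, h2, h3⟩
      exact ⟨⟨h2, Or.inl h1⟩, h3⟩
    · rintro ⟨⟨h1, h2⟩, h3⟩
      exact ⟨h2.resolve_right (not_lt.2 h3), h1, h3⟩
  rw [topLaw, Measure.restrict_congr_set (Ioc_ae_eq_Icc (μ := volume) (a := a) (b := a + 1)).symm,
    withDensity_apply _ measurableSet_Ioi, Measure.restrict_restrict measurableSet_Ioi, hset,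
    ← ofReal_integral_eq_lintegral_ofReal
      ((continuous_maxCDF_sub _ a).integrableOn_Icc.mono_set Set.Ioc_subset_Icc_self)
      (ae_of_all _ fun _ => maxCDF_nonneg _ _), ← intervalIntegral.integral_of_le hy2]
  congr 1
  rw [intervalIntegral.integral_congr (g := fun u => (u - a) ^ (n - 1))]
  · rw [intervalIntegral.integral_comp_sub_right (fun u => u ^ (n - 1)), integral_pow,
      Nat.sub_add_cancel hn, Nat.cast_sub hn]
    have : y - a = max 0 (min (x - a) 1) := by
      simp only [y]
      rw [← max_sub_sub_right, ← min_sub_sub_right]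
      simp
    rw [this]
    simp [maxCDF]
  · intro u hu
    rw [Set.uIcc_of_le hy2] at hu
    exact maxCDF_of_mem (by linarith [hu.1]) (by linarith [hu.2])

theorem prod_succAbove {M : Type*} [CommMonoid M] (f : Fin 3 → M) (i : Fin 3) :
    ∏ k, f (i.succAbove k) = ∏ j ∈ Finset.univ.erase i, f j := by
  have : (Finset.univ.erase i) = Finset.univ.map (Fin.succAboveEmb i) := by
    revert i
    decide
  rw [this, Finset.prod_map]
  rfl

/-- Condition on the i-th value. Each other factor is a tail of `topLaw`, whose 1 / n j is the
chance that the given edge is the heaviest of its path. -/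
theorem pi_topLaw_smallest {n : Fin 3 → ℕ} (hn : ∀ i, 1 ≤ n i) (a : Fin 3 → ℝ) (i : Fin 3) :
    (Measure.pi fun j => topLaw (n j) (a j)).real {x | ∀ j, j ≠ i → x i < x j} =
      smallestIntegral n a i / ∏ j ∈ Finset.univ.erase i, (n j : ℝ) := by
  have hset : {x : Fin 3 → ℝ | ∀ j, j ≠ i → x i < x j} =
      MeasurableEquiv.piFinSuccAbove (fun _ => ℝ) i ⁻¹' {p | ∀ k, p.1 < p.2 k} := by
    ext x
    simp only [Set.mem_preimage, Set.mem_ofPred_eq,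
      MeasurableEquiv.piFinSuccAbove_apply, Fin.insertNthEquiv_symm_apply]
    refine ⟨fun h k => h _ (Fin.succAbove_ne i k), fun h k hk => ?_⟩
    obtain ⟨l, rfl⟩ := Fin.exists_succAbove_eq hk
    exact h l
  have hmeas : MeasurableSet {p : ℝ × (Fin 2 → ℝ) | ∀ k, p.1 < p.2 k} := by measurability
  let F : ℝ → ℝ := fun x => maxCDF (n i - 1) (x - a i) *
    ∏ j ∈ Finset.univ.erase i, ((1 - maxCDF (n j) (x - a j)) / n j)
  have hF0 : ∀ x, 0 ≤ F x := fun x => mul_nonneg (maxCDF_nonneg _ _)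
    (Finset.prod_nonneg fun j _ => div_nonneg (sub_nonneg.2 (maxCDF_le_one _ _)) (by positivity))
  have hFc : Continuous F := by
    have := continuous_maxCDF_sub
    fun_prop
  have hlin : (Measure.pi fun j => topLaw (n j) (a j)) {x | ∀ j, j ≠ i → x i < x j} =
      ∫⁻ x in Set.Icc (a i) (a i + 1), ENNReal.ofReal (F x) := by
    rw [hset, (measurePreserving_piFinSuccAbove (fun j => topLaw (n j) (a j))
      i).measure_preimage hmeas.nullMeasurableSet, Measure.prod_apply hmeas]
    have hslice : ∀ x : ℝ, Prod.mk x ⁻¹' {p : ℝ × (Fin 2 → ℝ) | ∀ k, p.1 < p.2 k} =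
        Set.univ.pi fun _ => Set.Ioi x := fun x => by
      ext v
      simp
    simp only [hslice, Measure.pi_pi, topLaw_Ioi (hn _)]
    rw [topLaw, lintegral_withDensity_eq_lintegral_mul]
    · refine lintegral_congr fun x => ?_
      rw [Pi.mul_apply, prod_succAbove
        (fun j => ENNReal.ofReal ((1 - maxCDF (n j) (x - a j)) / n j)),
        ← ENNReal.ofReal_prod_of_nonneg fun j _ =>
          div_nonneg (sub_nonneg.2 (maxCDF_le_one _ _)) (by positivity),
        ← ENNReal.ofReal_mul (maxCDF_nonneg _ _)]
    · exact (continuous_maxCDF_sub _ _).measurable.ennreal_ofReal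
    · refine Finset.measurable_prod _ fun k _ => ?_
      exact ((continuous_const.sub (continuous_maxCDF_sub _ _)).div_const _).measurable.ennreal_ofReal
  rw [measureReal_def, hlin, ← ofReal_integral_eq_lintegral_ofReal hFc.integrableOn_Icc
    (ae_of_all _ hF0), ENNReal.toReal_ofReal (integral_nonneg hF0), integral_Icc_eq_integral_Ioc,
    ← intervalIntegral.integral_of_le (by linarith)]
  have hshift := intervalIntegral.integral_comp_add_right (a := 0) (b := 1) F (a i)
  rw [zero_add, add_comm 1 (a i)] at hshift
  rw [← hshift, smallestIntegral, ← intervalIntegral.integral_div]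
  refine intervalIntegral.integral_congr fun u hu => ?_
  rw [Set.uIcc_of_le zero_le_one] at hu
  simp only [F, Finset.prod_div_distrib, add_sub_cancel_right, maxCDF_of_mem hu.1 hu.2,
    add_sub_assoc, mul_div_assoc]

/-- Grouping the edges by path turns the law into a product over paths, and the cell into a product
event cut by a condition on the chosen coordinates alone. -/
theorem shiftedWeights_cell {r s t : ℕ} (a : Fin 3 → ℝ) (m : EdgeChoice r s t) (i : Fin 3) :
    shiftedWeights (fun e : ThetaEdge r s t => a e.1) (cell m i) =
      (Measure.pi fun j => topLaw (pathLength r s t j) (a j)) {x | ∀ j, j ≠ i → x i < x j} := by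
  let μ : ∀ j, Measure (Fin (pathLength r s t j) → ℝ) := fun j =>
    Measure.pi fun _ => volume.restrict (Set.Icc (a j) (a j + 1))
  let top : ∀ j, Set (Fin (pathLength r s t j) → ℝ) := fun j => {v | ∀ k, k ≠ m j → v k < v (m j)}
  have hcurry : (shiftedWeights fun e : ThetaEdge r s t => a e.1).map
      (MeasurableEquiv.piCurry fun (j : Fin 3) (_ : Fin (pathLength r s t j)) => ℝ) =
        Measure.pi μ := by
    have := Measure.infinitePi_map_piCurry
      (fun (j : Fin 3) (_ : Fin (pathLength r s t j)) => volume.restrict (Set.Icc (a j) (a j + 1)))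
    simp only [Measure.infinitePi_eq_pi] at this
    exact this
  have hlaw : (fun j => topLaw (pathLength r s t j) (a j)) =
      fun j => ((μ j).restrict (top j)).map fun v => v (m j) :=
    funext fun j => (map_eval_restrict_pi (m j) (a j)).symm
  have hR : MeasurableSet {x : Fin 3 → ℝ | ∀ j, j ≠ i → x i < x j} := by measurability
  have htop : ∀ j, MeasurableSet (top j) := fun j => by
    simp only [top]
    measurability
  rw [hlaw, ← Measure.pi_map_pi fun j => (measurable_pi_apply (m j)).aemeasurable,
    Measure.map_apply (by fun_prop) hR, ← Measure.restrict_pi_pi,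
    Measure.restrict_apply ((by fun_prop : Measurable fun (x : ∀ j, Fin (pathLength r s t j) → ℝ) j
      => x j (m j)) hR), ← hcurry, MeasurableEquiv.map_apply]
  congr 1
  ext w
  simp only [cell, top, Set.mem_ofPred_eq, Set.mem_preimage, Set.mem_inter_iff, Set.mem_pi,
    Set.mem_univ, true_imp_iff, MeasurableEquiv.coe_piCurry, Sigma.curry]
  exact And.comm

/-- The cells for the possible heaviest edges of the whole path are equally likely, giving one
factor n i; completing the product in the denominator gives the other. -/
theorem shiftedMST_spanningTreeOf_eq {r s t : ℕ} (hpos : ∀ i, 1 ≤ pathLength r s t i)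
    (a : Fin 3 → ℝ) (m : EdgeChoice r s t) (i : Fin 3) :
    shiftedMST (theta r s t) (fun e => a e.1) (spanningTreeOf m i) =
      (pathLength r s t i : ℝ) ^ 2 * smallestIntegral (pathLength r s t) a i /
        ∏ j, (pathLength r s t j : ℝ) := by
  have hne : ∀ j, (pathLength r s t j : ℝ) ≠ 0 := fun j => by
    have := hpos j
    positivity
  rw [shiftedMST_spanningTreeOf hpos]
  simp only [measureReal_def, shiftedWeights_cell]
  rw [← measureReal_def, pi_topLaw_smallest hpos, Finset.sum_const, Finset.card_univ,
    Fintype.card_fin, nsmul_eq_mul, ← Finset.mul_prod_erase _ _ (Finset.mem_univ i)]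
  have := hne i
  have := Finset.prod_ne_zero_iff.2 fun j (_ : j ∈ Finset.univ.erase i) => hne j
  field_simp

end RandomTrees

theorem theoremC2 (r s t : ℕ) (hr : 1 ≤ r) (hs : 1 ≤ s) (ht : 1 ≤ t) :
    ∃ S ∈ RandomTrees.thetaShifts r s t,
      RandomTrees.shiftedMST (RandomTrees.theta r s t) S =
        RandomTrees.ust (RandomTrees.theta r s t) := by
  open RandomTrees in
  have hpos : ∀ i, 1 ≤ pathLength r s t i := fun i => by
    fin_cases i <;> assumption
  obtain ⟨a, ha, heq⟩ := exists_mem_shiftahedron (pathLength r s t) hpos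
  refine ⟨fun e => a e.1, ⟨a, ha, rfl⟩, funext fun T => ?_⟩
  have := Fintype.ofFinite (SpanningTree (theta r s t))
  -- A constant function with total mass one is the uniform distribution.
  have hconst : ∀ T', shiftedMST (theta r s t) (fun e => a e.1) T' =
      shiftedMST (theta r s t) (fun e => a e.1) T := fun T' => by
    obtain ⟨m, i, rfl⟩ := exists_eq_spanningTreeOf hpos T
    obtain ⟨m', i', rfl⟩ := exists_eq_spanningTreeOf hpos T'
    rw [shiftedMST_spanningTreeOf_eq hpos, shiftedMST_spanningTreeOf_eq hpos, heq i i']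
  have hsum := sum_isMST_eq_one hpos fun e => a e.1
  simp only [hconst, Finset.sum_const, Finset.card_univ, nsmul_eq_mul] at hsum
  rw [ust, Nat.card_eq_fintype_card]
  exact eq_one_div_of_mul_eq_one_right hsum
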